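/- All graphs are finite and simple. For a graph $G$, let $\rho(G)$ denote the largest eigenvalue of its adjacency matrix. For an integer $k\ge 1$, a graph is called $k$-extendable if it has at least $2k+2$ vertices, has a perfect matching, and every matching consisting of exactly $k$ edges is contained in a perfect matching. Write $K_m$ for the complete graph on $m$ vertices, $\cup$ for disjoint union, and $G_1\vee G_2$ for the join, obtained from $G_1\cup G_2$ by adding all edges between $G_1$ and $G_2$. **Theorem 1.4.** Let $k\ge 1$ be an integer and let $n\ge 2k+2$ be an even integer. If $G$ is a connected graph on $n$ vertices with $$\rho(G)\ \ge\ \rho\bigl(K_{2k}\vee(K_{n-2k-1}\cup K_1)\bigr),$$ then $G$ is $k$-extendable, unless $G$ is isomorphic to $K_{2k}\vee(K_{n-2k-1}\cup K_1)$, in which case $G$ is not $k$-extendable. -/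

import Mathlib

namespace SimpleGraph

/-- The join `G ∨ H`: the disjoint union of `G` and `H`, together with all edges between a vertex
of `G` and a vertex of `H`. -/
def joinGraph {V W : Type*} (G : SimpleGraph V) (H : SimpleGraph W) : SimpleGraph (V ⊕ W) :=
  (G ⊕g H) ⊔ completeBipartiteGraph V W

/-- The graph `K_{2k} ∨ (K_{n-2k-1} ∪ K_1)`; it has `n` vertices when `2 * k + 1 ≤ n`. -/
def extremalGraph (n k : ℕ) : SimpleGraph (Fin (2 * k) ⊕ (Fin (n - 2 * k - 1) ⊕ Fin 1)) :=
  joinGraph (completeGraph (Fin (2 * k)))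
    (completeGraph (Fin (n - 2 * k - 1)) ⊕g completeGraph (Fin 1))

open Classical in
/-- The spectral radius `ρ(G)` of a finite graph: the largest eigenvalue of its real adjacency
matrix. -/
noncomputable def adjSpectralRadius {V : Type*} [Fintype V] (G : SimpleGraph V) : ℝ :=
  ⨆ i : V, (show (G.adjMatrix ℝ).IsHermitian from G.isSymm_adjMatrix).eigenvalues i

/-- A graph is `k`-extendable if it has at least `2 * k + 2` vertices, has a perfect matching, and
each of its matchings with exactly `k` edges is contained in a perfect matching. -/
structure IsKExtendable {V : Type*} [Fintype V] (G : SimpleGraph V) (k : ℕ) : Prop where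
  two_mul_add_two_le_card : 2 * k + 2 ≤ Fintype.card V
  exists_isPerfectMatching : ∃ P : G.Subgraph, P.IsPerfectMatching
  extends_matching : ∀ M : G.Subgraph, M.IsMatching → M.edgeSet.ncard = k →
    ∃ P : G.Subgraph, P.IsPerfectMatching ∧ M.edgeSet ⊆ P.edgeSet

end SimpleGraph

/-! If `G` is not `k`-extendable, Tutte's theorem, applied to `G` or to `G` minus the vertices of a
`k`-matching that does not extend, yields a set `S` of `s` vertices whose removal leaves at least
`max 2 (s - 2k + 2)` mutually non-adjacent pieces. So `G` lies in the join of a clique on `S` with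
disjoint cliques on the pieces.

Let `μ > n - 1` be a root of the quotient polynomial of the extremal graph; then `μ - 1` is one of
its eigenvalues, hence at most `ρ(G)`. For pieces of orders `m`, `mul_one_add_sum_div_sub_le` shows
`s * (1 + ∑ m / (μ - m)) ≤ μ`: convexity of `t / (μ - t)` reduces to one large piece and singletons,
and explicit inequalities in `s` do the rest. This bound gives a positive vector `x` with `A x ≤ (μ
- 1) x`. Since `G` is connected and `ρ(G) ≥ μ - 1`, equality holds throughout: no edge of the join
is missing, `s = 2k`, and there are two pieces, one a single vertex. -/

namespace SimpleGraph

/-! ### Matchings and Tutte separations -/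

open Classical in
/-- A matching covers twice as many vertices as it has edges. -/
theorem Subgraph.IsMatching.ncard_verts {V : Type*} [Finite V] {G : SimpleGraph V}
    {M : G.Subgraph} (hM : M.IsMatching) : M.verts.ncard = 2 * M.edgeSet.ncard := by
  cases nonempty_fintype V
  have h := M.spanningCoe.sum_degrees_eq_twice_card_edges
  have hdeg : ∀ v, M.spanningCoe.degree v = if v ∈ M.verts then 1 else 0 := by
    intro v
    rw [Subgraph.degree_spanningCoe]
    split_ifs with hv
    · exact Subgraph.isMatching_iff_forall_degree.mp hM v hv
    · exact Subgraph.degree_of_notMem_verts hv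
  simp_rw [hdeg] at h
  rw [Finset.sum_boole, Nat.cast_id] at h
  have hE : M.edgeSet.ncard = M.spanningCoe.edgeFinset.card := by
    rw [← Set.ncard_coe_finset, coe_edgeFinset, Subgraph.edgeSet_spanningCoe]
  rw [hE, ← h, ← Set.ncard_coe_finset]
  congr 1
  ext v
  simp

open Classical in
/-- A graph of even order without a perfect matching has a vertex set `T` whose removal leaves at
least `|T| + 2` pieces, no two of which are joined by an edge. -/
theorem exists_separation_of_isMatchingFree {W : Type*} [Fintype W] (H : SimpleGraph W)
    (hW : Even (Fintype.card W)) (hH : ¬ ∃ P : H.Subgraph, P.IsPerfectMatching) :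
    ∃ (T : Finset W) (κ : W → Set W), (∀ u v, u ∉ T → v ∉ T → H.Adj u v → κ u = κ v) ∧
      T.card + 2 ≤ (Tᶜ.image κ).card := by
  rw [tutte] at hH
  push Not at hH
  obtain ⟨u, hu⟩ := hH
  unfold IsTutteViolator at hu
  set K := ((⊤ : H.Subgraph).deleteVerts u) with hK
  have hverts : K.verts = uᶜ := by simp [hK, Set.compl_eq_univ_sdiff]
  -- The order is even, so the number of odd components has the parity of `|u|`; an excess of one is
  -- impossible.
  have hpar : u.ncard + 2 ≤ K.coe.oddComponents.ncard := by
    have h1 := K.coe.odd_ncard_oddComponents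
    have h2 : Nat.card K.verts + u.ncard = Fintype.card W := by
      rw [Nat.card_coe_set_eq, hverts, add_comm, Set.ncard_add_ncard_compl, Nat.card_eq_fintype_card]
    have h3 : ¬ Odd (Nat.card K.verts + u.ncard) := by
      rw [h2]; exact Nat.not_odd_iff_even.mpr hW
    rw [Nat.odd_add] at h3
    by_contra hlt
    have h4 : K.coe.oddComponents.ncard = u.ncard + 1 := by omega
    rw [h4, Nat.odd_add_one, Nat.not_odd_iff_even] at h1
    tauto
  let κ : W → Set W := fun w =>
    if h : w ∈ K.verts then Subtype.val '' (K.coe.connectedComponentMk ⟨w, h⟩).supp else ∅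
  refine ⟨u.toFinset, κ, ?_, ?_⟩
  · intro a b ha hb hab
    have ha' : a ∈ K.verts := by rw [hverts]; simpa using ha
    have hb' : b ∈ K.verts := by rw [hverts]; simpa using hb
    simp only [κ, dif_pos ha', dif_pos hb']
    have : K.coe.Adj ⟨a, ha'⟩ ⟨b, hb'⟩ := by
      change K.Adj a b
      rw [hK, Subgraph.deleteVerts_adj]
      simp at ha hb
      simp [ha, hb, hab]
    rw [ConnectedComponent.eq.mpr this.reachable]
  · rw [← Set.ncard_eq_toFinset_card']
    refine hpar.trans ?_
    refine (Set.ncard_le_ncard (Set.subset_univ _)).trans ?_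
    rw [← Set.ncard_coe_finset]
    refine Set.ncard_le_ncard_of_injOn (fun c => Subtype.val '' c.supp) ?_ ?_
    · intro c _
      induction c using ConnectedComponent.ind with | _ v =>
      obtain ⟨v, hv⟩ := v
      simp only [Finset.coe_image, Set.mem_image]
      refine ⟨v, ?_, ?_⟩
      · have := hv
        rw [hverts] at this
        simpa using this
      · simp only [κ, dif_pos hv]
    · intro c _ d _ hcd
      exact ConnectedComponent.supp_injective (Subtype.val_injective.image_injective hcd)

/-- A matching whose uncovered vertices induce a graph with a perfect matching extends to a perfect
matching. -/
theorem Subgraph.IsMatching.exists_isPerfectMatching_of_induce {V : Type*} {G : SimpleGraph V}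
    {M : G.Subgraph} (hM : M.IsMatching)
    (h : ∃ P : (G.induce M.vertsᶜ).Subgraph, P.IsPerfectMatching) :
    ∃ P : G.Subgraph, P.IsPerfectMatching ∧ M.edgeSet ⊆ P.edgeSet := by
  obtain ⟨P, hP, hPs⟩ := h
  let f : G.induce M.vertsᶜ ↪g G := Embedding.induce _
  have hP' : (P.map f.toHom).IsMatching := Subgraph.IsMatching.map f.toHom f.injective hP
  have hv : (P.map f.toHom).verts = M.vertsᶜ := by
    rw [Subgraph.map_verts, hPs.verts_eq_univ]
    ext v
    simp [f]
  refine ⟨M ⊔ P.map f.toHom, ⟨hM.sup hP' ?_, ?_⟩, ?_⟩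
  · rw [hM.support_eq_verts, hP'.support_eq_verts, hv]
    exact disjoint_compl_right
  · intro v
    rw [Subgraph.verts_sup, hv]
    simp
  · rw [Subgraph.edgeSet_sup]
    exact Set.subset_union_left

open Classical in
/-- A graph of even order that is not `k`-extendable has a vertex set `S` whose removal leaves at
least `max 2 (|S| - 2k + 2)` pieces, no two of which are joined by an edge. -/
theorem exists_separation_of_not_isKExtendable {V : Type*} [Fintype V] (G : SimpleGraph V) (k : ℕ)
    (hk : 1 ≤ k) (hcard : 2 * k + 2 ≤ Fintype.card V) (hV : Even (Fintype.card V))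
    (h : ¬ G.IsKExtendable k) :
    ∃ (S : Finset V) (κ : V → Set V), (∀ u v, u ∉ S → v ∉ S → G.Adj u v → κ u = κ v) ∧
      2 ≤ (Sᶜ.image κ).card ∧ S.card + 2 ≤ (Sᶜ.image κ).card + 2 * k := by
  by_cases hPM : ∃ P : G.Subgraph, P.IsPerfectMatching
  · have : ¬ ∀ M : G.Subgraph, M.IsMatching → M.edgeSet.ncard = k →
        ∃ P : G.Subgraph, P.IsPerfectMatching ∧ M.edgeSet ⊆ P.edgeSet :=
      fun h' => h ⟨hcard, hPM, h'⟩
    push Not at this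
    obtain ⟨M, hM, hMk, hno⟩ := this
    have hMv := hM.ncard_verts
    rw [hMk] at hMv
    have hno' : ¬ ∃ P : (G.induce M.vertsᶜ).Subgraph, P.IsPerfectMatching := by
      intro hP
      obtain ⟨P, hP, hMP⟩ := hM.exists_isPerfectMatching_of_induce hP
      exact hno P hP hMP
    have hsum := Set.ncard_add_ncard_compl M.verts
    have heven : Even (Fintype.card (M.vertsᶜ : Set V)) := by
      rw [← Nat.card_eq_fintype_card, Nat.card_coe_set_eq]
      rw [Nat.card_eq_fintype_card] at hsum
      rw [← hsum, hMv] at hV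
      exact (Nat.even_add.mp hV).mp (even_two_mul k)
    obtain ⟨T, κ, hκ, hT⟩ := exists_separation_of_isMatchingFree _ heven hno'
    have hdisj : Disjoint M.verts.toFinset (T.map (Function.Embedding.subtype _)) := by
      rw [Finset.disjoint_left]
      intro v hv hv'
      obtain ⟨w, -, rfl⟩ := Finset.mem_map.mp hv'
      exact w.2 (by simpa using hv)
    have hmem : ∀ v (hv : v ∈ M.vertsᶜ),
        v ∉ M.verts.toFinset ∪ T.map (Function.Embedding.subtype _) ↔ (⟨v, hv⟩ : _) ∉ T := by
      intro v hv
      have hv' : v ∉ M.verts := hv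
      simp [hv']
    let κ' : V → Set V := fun v => if h : v ∈ M.vertsᶜ then Subtype.val '' κ ⟨v, h⟩ else ∅
    have himg : T.card + 2 ≤ ((M.verts.toFinset ∪
        T.map (Function.Embedding.subtype _))ᶜ.image κ').card := by
      refine hT.trans ?_
      rw [← Finset.card_image_of_injective _
        (Subtype.val_injective (p := (· ∈ M.vertsᶜ))).image_injective]
      refine Finset.card_le_card ?_
      intro A hA
      simp only [Finset.mem_image, Finset.mem_compl] at hA ⊢
      obtain ⟨_, ⟨⟨v, hv⟩, hvT, rfl⟩, rfl⟩ := hA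
      exact ⟨v, (hmem v hv).mpr hvT, by simp only [κ', dif_pos hv]⟩
    -- `M` covers `2k` vertices, so this set has order `2k + |T|`, while at least `|T| + 2` pieces
    -- remain.
    refine ⟨M.verts.toFinset ∪ T.map (Function.Embedding.subtype _), κ', ?_, ?_, ?_⟩
    · intro u v hu hv huv
      have hu' : u ∈ M.vertsᶜ := by simp at hu; simpa using hu.1
      have hv' : v ∈ M.vertsᶜ := by simp at hv; simpa using hv.1
      simp only [κ', dif_pos hu', dif_pos hv']
      rw [hκ ⟨u, hu'⟩ ⟨v, hv'⟩ ((hmem u hu').mp hu) ((hmem v hv').mp hv) (by simpa using huv)]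
    · omega
    · rw [Finset.card_union_of_disjoint hdisj, ← Set.ncard_eq_toFinset_card', Finset.card_map]
      omega
  · obtain ⟨T, κ, hκ, hT⟩ := exists_separation_of_isMatchingFree _ hV hPM
    exact ⟨T, κ, hκ, by omega, by omega⟩

/-- A graph with a clique of order `2k` containing all neighbours of some vertex outside it is not
`k`-extendable. -/
theorem not_isKExtendable_of_isClique {V : Type*} [Fintype V] (G : SimpleGraph V) (k : ℕ)
    {S : Set V} (hS : G.IsClique S) (hcard : S.ncard = 2 * k) {w : V} (hw : w ∉ S)
    (hadj : ∀ v, G.Adj w v → v ∈ S) : ¬ G.IsKExtendable k := by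
  intro h
  -- A perfect matching of the clique has `k` edges and uses up every possible partner of `w`.
  obtain ⟨M, hMv, hM⟩ := (hS.even_iff_exists_isMatching S.toFinite).mp (hcard ▸ even_two_mul k)
  have hMk : M.edgeSet.ncard = k := by
    have := hM.ncard_verts
    rw [hMv] at this
    omega
  obtain ⟨P, ⟨hP, hPs⟩, hMP⟩ := h.extends_matching M hM hMk
  obtain ⟨v, hv, -⟩ := hP (hPs w)
  have hvS := hadj v hv.adj_sub
  rw [← hMv] at hvS
  obtain ⟨u, hu, -⟩ := hM hvS
  have huP : P.Adj v u := hMP (Subgraph.mem_edgeSet.mpr hu)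
  have : w = u := hP.eq_of_adj_left hv.symm huP
  exact hw (by rw [this, ← hMv]; exact M.edge_vert hu.symm)

end SimpleGraph

/-! ### Spectral radius and positive test vectors -/

namespace SimpleGraph

open Classical in
theorem exists_eigenvector_adjSpectralRadius {V : Type*} [Fintype V] [Nonempty V]
    (G : SimpleGraph V) :
    ∃ y : V → ℝ, y ≠ 0 ∧ ∀ v, ∑ u ∈ G.neighborFinset v, y u = G.adjSpectralRadius * y v := by
  have hA : (G.adjMatrix ℝ).IsHermitian := G.isSymm_adjMatrix
  obtain ⟨i, hi⟩ := exists_eq_ciSup_of_finite (f := hA.eigenvalues)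
  have hi' : hA.eigenvalues i = G.adjSpectralRadius := hi
  refine ⟨⇑(hA.eigenvectorBasis i), ?_, fun v => ?_⟩
  · intro h
    apply hA.eigenvectorBasis.orthonormal.ne_zero i
    ext v
    exact congrFun h v
  · have := congrFun (hA.mulVec_eigenvectorBasis i) v
    rw [hi'] at this
    simpa [adjMatrix_mulVec_apply] using this

open Classical in
theorem le_adjSpectralRadius {V : Type*} [Fintype V] (G : SimpleGraph V) {y : V → ℝ} (hy : y ≠ 0)
    {l : ℝ} (h : ∀ v, ∑ u ∈ G.neighborFinset v, y u = l * y v) : l ≤ G.adjSpectralRadius := by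
  have hA : (G.adjMatrix ℝ).IsHermitian := G.isSymm_adjMatrix
  have hev : Module.End.HasEigenvalue (Matrix.toLin' (G.adjMatrix ℝ)) l := by
    refine Module.End.hasEigenvalue_of_hasEigenvector (x := y) ⟨?_, hy⟩
    rw [Module.End.mem_eigenspace_iff]
    ext v
    simpa [adjMatrix_mulVec_apply] using h v
  have hspec := hev.mem_spectrum
  rw [Matrix.spectrum_toLin', hA.spectrum_real_eq_range_eigenvalues] at hspec
  obtain ⟨i, hi⟩ := hspec
  rw [← hi]
  exact le_ciSup (f := hA.eigenvalues) (Set.finite_range _).bddAbove i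

open Classical in
/-- A positive vector `x` with `A x ≤ l x` on a connected graph whose spectral radius is at least
`l` is an eigenvector for `l`. -/
theorem Connected.sum_neighborFinset_eq_of_le {V : Type*} [Fintype V] {G : SimpleGraph V}
    (hG : G.Connected) {x : V → ℝ} (hx : ∀ v, 0 < x v) {l : ℝ}
    (hle : ∀ v, ∑ u ∈ G.neighborFinset v, x u ≤ l * x v) (hl : l ≤ G.adjSpectralRadius) (v : V) :
    ∑ u ∈ G.neighborFinset v, x u = l * x v := by
  have := hG.nonempty
  obtain ⟨y, hy0, hy⟩ := G.exists_eigenvector_adjSpectralRadius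
  -- Maximum principle: where `|y| / x` is maximal, the eigenvalue equation forces equality in all
  -- estimates, so the maximum passes to every neighbour. Absolute values avoid the need for a
  -- nonnegative eigenvector.
  obtain ⟨w, hw⟩ := Finite.exists_max (fun v => |y v| / x v)
  set t := |y w| / x w with ht
  have hyx : ∀ v, |y v| ≤ t * x v := fun v => (div_le_iff₀ (hx v)).mp (hw v)
  have htpos : 0 < t := by
    by_contra hneg
    apply hy0
    ext v
    have h1 := hyx v
    have h2 : t * x v ≤ 0 := mul_nonpos_of_nonpos_of_nonneg (not_lt.mp hneg) (hx v).le
    exact abs_nonpos_iff.mp (h1.trans h2)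
  have key : ∀ v, |y v| = t * x v → ∑ u ∈ G.neighborFinset v, x u = l * x v ∧
      ∀ u, G.Adj v u → |y u| = t * x u := by
    intro v hv
    have h1 : l * (t * x v) ≤ ∑ u ∈ G.neighborFinset v, |y u| := by
      calc l * (t * x v) ≤ G.adjSpectralRadius * (t * x v) :=
            mul_le_mul_of_nonneg_right hl (mul_pos htpos (hx v)).le
        _ ≤ |G.adjSpectralRadius * y v| := by
            rw [abs_mul, hv]
            exact mul_le_mul_of_nonneg_right (le_abs_self _) (mul_pos htpos (hx v)).le
        _ = |∑ u ∈ G.neighborFinset v, y u| := by rw [hy]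
        _ ≤ _ := Finset.abs_sum_le_sum_abs _ _
    have h2 : ∑ u ∈ G.neighborFinset v, |y u| ≤ ∑ u ∈ G.neighborFinset v, t * x u :=
      Finset.sum_le_sum fun u _ => hyx u
    have h3 : ∑ u ∈ G.neighborFinset v, t * x u = t * ∑ u ∈ G.neighborFinset v, x u :=
      (Finset.mul_sum _ _ _).symm
    have h4 : t * ∑ u ∈ G.neighborFinset v, x u ≤ t * (l * x v) :=
      mul_le_mul_of_nonneg_left (hle v) htpos.le
    refine ⟨mul_left_cancel₀ htpos.ne' (by linarith), fun u hu => ?_⟩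
    exact (Finset.sum_eq_sum_iff_of_le fun u _ => hyx u).mp (by linarith) u
      ((G.mem_neighborFinset v u).mpr hu)
  have hall : ∀ v, |y v| = t * x v := by
    intro v
    obtain ⟨p⟩ := hG.preconnected w v
    have hstart : |y w| = t * x w := by rw [ht, div_mul_cancel₀ _ (hx w).ne']
    -- The start of the walk varies in the induction, so the facts tying `t` to it are dropped.
    clear hw ht
    clear_value t
    induction p with
    | nil => exact hstart
    | cons hadj _ ih => exact ih ((key _ hstart).2 _ hadj)
  exact (key v (hall v)).1

end SimpleGraph

/-! ### Real inequalities for the quotient polynomials -/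

theorem div_sub_le_chord {μ a m : ℝ} (h1 : 1 ≤ m) (hma : m ≤ a) (ha : a < μ) :
    m / (μ - m) ≤ 1 / (μ - 1) + (m - 1) * (μ / ((μ - a) * (μ - 1))) := by
  have e1 : 0 < μ - m := by linarith
  have e2 : 0 < μ - 1 := by linarith
  have e3 : 0 < μ - a := by linarith
  -- Convexity of `t / (μ - t)` made explicit: the gap below the chord over `[1, a]` factors and
  -- vanishes only at the endpoints.
  have : 1 / (μ - 1) + (m - 1) * (μ / ((μ - a) * (μ - 1))) - m / (μ - m)
      = μ * ((m - 1) * (a - m)) / ((μ - a) * (μ - 1) * (μ - m)) := by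
    field_simp
    ring
  have h : 0 ≤ μ * ((m - 1) * (a - m)) / ((μ - a) * (μ - 1) * (μ - m)) := by
    have : 0 ≤ μ := by linarith
    have : 0 ≤ m - 1 := by linarith
    have : 0 ≤ a - m := by linarith
    positivity
  linarith

theorem eq_one_or_eq_of_div_sub_eq_chord {μ a m : ℝ} (h1 : 1 ≤ m) (hma : m ≤ a) (ha : a < μ)
    (h : m / (μ - m) = 1 / (μ - 1) + (m - 1) * (μ / ((μ - a) * (μ - 1)))) : m = 1 ∨ m = a := by
  have e1 : 0 < μ - m := by linarith
  have e2 : 0 < μ - 1 := by linarith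
  have e3 : 0 < μ - a := by linarith
  have e4 : 0 < μ := by linarith
  have : 1 / (μ - 1) + (m - 1) * (μ / ((μ - a) * (μ - 1))) - m / (μ - m)
      = μ * ((m - 1) * (a - m)) / ((μ - a) * (μ - 1) * (μ - m)) := by
    field_simp
    ring
  rw [← h, sub_self, eq_comm, div_eq_zero_iff] at this
  rcases this with h0 | h0
  · rcases mul_eq_zero.mp ((mul_eq_zero.mp h0).resolve_left e4.ne') with h' | h'
    · left; linarith
    · right; linarith
  · exact absurd h0 (by positivity)

/-- Let `μ` be the root of the quotient polynomial of the extremal graph. The left-hand side is the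
analogous expression for a separating set that is larger by `j`. -/
theorem quotient_lt_of_lt (c j a : ℕ) (hc : 2 ≤ c) (hj : 1 ≤ j) (ha : 1 ≤ a) {μ : ℝ}
    (hμ : (a + 2 * j + c : ℝ) < μ)
    (hroot : c * (μ * (μ - 1) + (μ - (a + 2 * j))) = μ * (μ - 1) * (μ - (a + 2 * j))) :
    (c + j) * (μ / (μ - a) + (j + 1) / (μ - 1)) < μ := by
  have hc' : (2 : ℝ) ≤ c := by exact_mod_cast hc
  have hj' : (1 : ℝ) ≤ j := by exact_mod_cast hj
  have ha' : (1 : ℝ) ≤ a := by exact_mod_cast ha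
  obtain ⟨δ, rfl⟩ : ∃ δ, μ = a + 2 * j + c + δ := ⟨μ - (a + 2 * j + c), by ring⟩
  have hδ : 0 < δ := by linarith
  set μ : ℝ := a + 2 * j + c + δ with hμdef
  have hroot' : c * (c + δ) = δ * (μ * (μ - 1)) := by
    have : μ - (a + 2 * j) = c + δ := by rw [hμdef]; ring
    rw [this] at hroot
    linarith
  -- This is the claim with denominators cleared and `δ * (μ * (μ - 1))` replaced through the root
  -- equation.
  have key : (c + j) * (j + 1) * (c + δ + 2 * j) < c * (c + δ) + j * (μ * (μ - 1)) := by
    have hdiff : c * (c + δ) + j * ((1 + 2 * j + c + δ) * (2 * j + c + δ))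
        - (c + j) * (j + 1) * (c + δ + 2 * j) = j * ((c + δ + 2 * j) * (j + δ) - 2 * c) := by ring
    have hmono : ∀ t : ℝ, 0 ≤ t → t + 2 * j + c + δ ≤ μ →
        (t + 2 * j + c + δ) * (t + 2 * j + c + δ - 1) ≤ μ * (μ - 1) := by
      intro t ht htμ
      apply mul_le_mul htμ (by linarith) (by linarith) (by linarith)
    rcases Nat.lt_or_ge 1 j with hj2 | hj1
    · have hj2' : (2 : ℝ) ≤ j := by exact_mod_cast hj2
      have h1 := hmono 1 zero_le_one (by linarith)
      have h2 : 0 < (c + δ + 2 * j) * (j + δ) - 2 * c := by nlinarith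
      have h3 := mul_le_mul_of_nonneg_left h1 (by linarith : (0 : ℝ) ≤ j)
      have h4 := mul_pos (by linarith : (0 : ℝ) < j) h2
      have h5 : (1 + 2 * j + c + δ) * (1 + 2 * j + c + δ - 1)
        = (1 + 2 * j + c + δ) * (2 * j + c + δ) := by ring
      rw [h5] at h3
      linarith
    · obtain rfl : j = 1 := le_antisymm hj1 hj
      rcases Nat.lt_or_ge 1 a with ha2 | ha1
      · have ha2' : (2 : ℝ) ≤ a := by exact_mod_cast ha2
        have h1 := hmono 2 zero_le_two (by linarith)
        push_cast at h1 ⊢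
        nlinarith [mul_pos hδ hδ, mul_pos hδ (by linarith : (0 : ℝ) < c)]
      · obtain rfl : a = 1 := le_antisymm ha1 ha
        push_cast at *
        -- For `j = a = 1` positivity of `δ` does not suffice: at `δ = 0` this is `2 - c`. The root
        -- equation keeps `δ` away from zero.
        have hE : 0 < δ ^ 2 + (c + 3) * δ + 2 - c := by
          by_contra hneg
          have hy : δ ^ 2 + (c + 3) * δ ≤ c - 2 := by linarith
          have h1 : (δ ^ 2 + (c + 3) * δ) * (δ + c + 2) ≤ (c - 2) * (δ + c + 2) :=
            mul_le_mul_of_nonneg_right hy (by linarith)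
          have h2 : δ * (μ * (μ - 1)) = (δ ^ 2 + (c + 3) * δ) * (δ + c + 2) := by
            rw [hμdef]; ring
          nlinarith
        have h2 : μ * (μ - 1) = (c + δ + 3) * (c + δ + 2) := by rw [hμdef]; ring
        rw [h2]
        nlinarith
  have e1 : 0 < μ - a := by linarith
  have e2 : 0 < μ - 1 := by linarith
  have hsum : (c + j : ℝ) * (μ / (μ - a) + (j + 1) / (μ - 1))
      = ((c + j) * (μ * (μ - 1)) + (c + j) * (j + 1) * (μ - a)) / ((μ - a) * (μ - 1)) := by
    field_simp
  rw [hsum, div_lt_iff₀ (mul_pos e1 e2)]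
  have hs : μ - a = c + δ + 2 * j := by rw [hμdef]; ring
  have : μ * ((μ - a) * (μ - 1)) = (c + j) * (μ * (μ - 1)) + (δ + j) * (μ * (μ - 1)) := by
    rw [hs]; ring
  rw [this, hs]
  linarith

/-- The case of a separating set smaller than `c = 2k`, with parts `b + (c - s)` and `1`. By the
root equation it reduces to `s * (μ - b - c + s) < c * (μ - b)`, where both factors on the left are
the smaller ones. -/
theorem quotient_lt_of_gt (s c b : ℝ) (hs : 0 ≤ s) (hsc : s < c) (hb : 1 ≤ b) {μ : ℝ}
    (hμ : b + c < μ) (hroot : c * (μ * (μ - 1) + (μ - b)) = μ * (μ - 1) * (μ - b)) :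
    s * (μ / (μ - (b + (c - s))) + 1 / (μ - 1)) < μ := by
  have e1 : 0 < μ - (b + (c - s)) := by linarith
  have e2 : 0 < μ - 1 := by linarith
  have e0 : 0 < μ := by linarith
  have hsum : s * (μ / (μ - (b + (c - s))) + 1 / (μ - 1))
      = s * (μ * (μ - 1) + (μ - (b + (c - s)))) / ((μ - (b + (c - s))) * (μ - 1)) := by
    field_simp
  rw [hsum, div_lt_iff₀ (mul_pos e1 e2)]
  have hP := mul_pos e0 e2
  have : μ * (μ - 1) * (μ - b - c) = c * (μ - b) := by linarith
  have h2 : s * (μ - (b + (c - s))) < c * (μ - b) := by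
    apply mul_lt_mul'' hsc (by linarith) hs e1.le
  nlinarith

/-- The quotient polynomial of the extremal graph has a root exceeding its order minus one. -/
theorem exists_quotient_root (c b : ℝ) (hc : 2 ≤ c) (hb : 1 ≤ b) :
    ∃ μ : ℝ, b + c < μ ∧ c * (μ * (μ - 1) + (μ - b)) = μ * (μ - 1) * (μ - b) := by
  let f : ℝ → ℝ := fun μ => c * (μ * (μ - 1) + (μ - b)) - μ * (μ - 1) * (μ - b)
  have hf : ContinuousOn f (Set.Icc (b + c) (b + c + 1)) := by fun_prop
  have h0 : f (b + c) = c ^ 2 := by simp only [f]; ring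
  have h1 : f (b + c + 1) < 0 := by simp only [f]; nlinarith
  obtain ⟨μ, hμ, hfμ⟩ := intermediate_value_Icc' (by linarith) hf
    (show (0 : ℝ) ∈ Set.Icc _ _ from ⟨h1.le, by rw [h0]; positivity⟩)
  refine ⟨μ, lt_of_le_of_ne hμ.1 ?_, by simp only [f] at hfμ; linarith⟩
  rintro rfl
  rw [h0] at hfμ
  nlinarith

/-! ### Spectral comparison with the join of cliques -/

namespace SimpleGraph
open Finset in
open Classical in
/-- Let the pieces `κ⁻¹(c)` of `G - S` be pairwise non-adjacent. If `S` is small in terms of `μ` and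
`μ - 1` is at most the spectral radius, then `G` is the join of a clique on `S` and the disjoint
union of cliques on the pieces. -/
theorem Connected.adj_iff_of_separation {V ι : Type*} [Fintype V] [DecidableEq ι]
    {G : SimpleGraph V}
    (hG : G.Connected) (S : Finset V) (κ : V → ι)
    (hκ : ∀ u v, u ∉ S → v ∉ S → G.Adj u v → κ u = κ v) {μ : ℝ} (hμ : 0 < μ)
    (hm : ∀ v ∉ S, (#{u ∈ Sᶜ | κ u = κ v} : ℝ) < μ)
    (hS : S.card * (1 + ∑ v ∈ Sᶜ, 1 / (μ - #{u ∈ Sᶜ | κ u = κ v})) ≤ μ)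
    (hρ : μ - 1 ≤ G.adjSpectralRadius) :
    S.card * (1 + ∑ v ∈ Sᶜ, 1 / (μ - #{u ∈ Sᶜ | κ u = κ v})) = μ ∧
      ∀ u v, G.Adj u v ↔ u ≠ v ∧ (u ∈ S ∨ v ∈ S ∨ κ u = κ v) := by
  set m : V → ℝ := fun v => (#{u ∈ Sᶜ | κ u = κ v} : ℝ) with hmdef
  set T : ℝ := ∑ v ∈ Sᶜ, 1 / (μ - m v) with hT
  have hm' : ∀ v ∉ S, 0 < μ - m v := fun v hv => sub_pos.mpr (hm v hv)
  have hT0 : 0 ≤ T := Finset.sum_nonneg fun v hv =>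
    (one_div_pos.mpr (hm' v (Finset.mem_compl.mp hv))).le
  change S.card * (1 + T) ≤ μ at hS
  change S.card * (1 + T) = μ ∧ _
  -- These values solve the eigenvalue equations of the join for `μ - 1`, provided the entries on
  -- `S` sum to one. In general every vertex has the same defect, one minus that sum (`hdef`).
  let x : V → ℝ := fun v => if v ∈ S then (1 + T) / μ else 1 / (μ - m v)
  have hxS : ∀ v ∈ S, x v = (1 + T) / μ := fun v hv => if_pos hv
  have hxC : ∀ v ∉ S, x v = 1 / (μ - m v) := fun v hv => if_neg hv
  have hx : ∀ v, 0 < x v := by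
    intro v
    by_cases hv : v ∈ S
    · rw [hxS v hv]; positivity
    · rw [hxC v hv]; exact one_div_pos.mpr (hm' v hv)
  have hsumS : ∑ u ∈ S, x u = S.card * (1 + T) / μ := by
    rw [Finset.sum_congr rfl hxS, Finset.sum_const, nsmul_eq_mul]; ring
  have hsumC : ∑ u ∈ Sᶜ, x u = T :=
    Finset.sum_congr rfl fun u hu => hxC u (Finset.mem_compl.mp hu)
  let F : V → Finset V := fun v => {u | u ≠ v ∧ (v ∈ S ∨ u ∈ S ∨ κ v = κ u)}
  have hNF : ∀ v, G.neighborFinset v ⊆ F v := by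
    intro v u hu
    rw [mem_neighborFinset] at hu
    simp only [F, Finset.mem_filter_univ]
    refine ⟨hu.ne', ?_⟩
    by_contra! hcon
    exact hcon.2.2 (hκ v u hcon.1 hcon.2.1 hu)
  have hFS : ∀ v ∈ S, ∑ u ∈ F v, x u = S.card * (1 + T) / μ + T - x v := by
    intro v hv
    have : F v = Finset.univ.erase v := by ext u; simp [F, hv]
    rw [this, Finset.sum_erase_eq_sub (Finset.mem_univ v), ← Finset.sum_add_sum_compl S, hsumS,
      hsumC]
  have hFC : ∀ v ∉ S, ∑ u ∈ F v, x u = S.card * (1 + T) / μ + m v * x v - x v := by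
    intro v hv
    have : F v = (S ∪ {u ∈ Sᶜ | κ u = κ v}).erase v := by
      ext u
      simp only [F, hv, false_or, Finset.mem_filter, Finset.mem_univ, true_and, Finset.mem_erase, Finset.mem_union,
        Finset.mem_compl, eq_comm (a := κ v)]
      tauto
    rw [this, Finset.sum_erase_eq_sub (by simp [hv]), Finset.sum_union, hsumS]
    · congr 2
      have hc : ∀ u ∈ ({u ∈ Sᶜ | κ u = κ v} : Finset V), x u = x v := by
        intro u hu
        rw [Finset.mem_filter, Finset.mem_compl] at hu
        rw [hxC u hu.1, hxC v hv, hmdef]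
        simp only [hu.2]
      rw [Finset.sum_congr rfl hc, Finset.sum_const, nsmul_eq_mul]
    · exact Finset.disjoint_left.mpr fun u hu hu' => by simp [hu] at hu'
  have hdef : ∀ v, ∑ u ∈ F v, x u = (μ - 1) * x v - (1 - S.card * (1 + T) / μ) := by
    intro v
    by_cases hv : v ∈ S
    · have : μ * x v = 1 + T := by rw [hxS v hv]; field_simp
      rw [hFS v hv]; linear_combination -this
    · have : (μ - m v) * x v = 1 := by
        rw [hxC v hv]; exact mul_one_div_cancel (hm' v hv).ne'
      rw [hFC v hv]; linear_combination -this
  have hS' : S.card * (1 + T) / μ ≤ 1 := (div_le_one hμ).mpr hS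
  have hle : ∀ v, ∑ u ∈ G.neighborFinset v, x u ≤ ∑ u ∈ F v, x u := fun v =>
    Finset.sum_le_sum_of_subset_of_nonneg (hNF v) fun u _ _ => (hx u).le
  have heq := hG.sum_neighborFinset_eq_of_le hx
    (fun v => (hle v).trans (by rw [hdef v]; linarith)) hρ
  constructor
  · obtain ⟨v⟩ := hG.nonempty
    have h1 := hle v
    rw [heq, hdef] at h1
    have h2 : S.card * (1 + T) / μ = 1 := by linarith
    rwa [div_eq_one_iff_eq hμ.ne'] at h2
  · intro u v
    have hF : G.neighborFinset u = F u := by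
      by_contra hne
      have hlt : ∑ w ∈ G.neighborFinset u, x w < ∑ w ∈ F u, x w := by
        obtain ⟨w, hw, hw'⟩ := Finset.exists_of_ssubset ((hNF u).ssubset_of_ne hne)
        exact Finset.sum_lt_sum_of_subset (hNF u) hw hw' (hx w) fun u _ _ => (hx u).le
      rw [heq, hdef] at hlt
      linarith
    rw [← mem_neighborFinset, hF]
    simp [F, ne_comm]

open Classical in
/-- The spectral radius of the extremal graph is at least any `μ - 1` with `μ` a root of its
quotient polynomial. -/
theorem sub_one_le_adjSpectralRadius_extremalGraph (n k : ℕ) (hk : 1 ≤ k) {b : ℕ}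
    (hb : n - 2 * k - 1 = b) (hb1 : 1 ≤ b) {μ : ℝ} (hμ : (b + 2 * k : ℝ) < μ)
    (hroot : (2 * k : ℝ) * (μ * (μ - 1) + (μ - b)) = μ * (μ - 1) * (μ - b)) :
    μ - 1 ≤ (extremalGraph n k).adjSpectralRadius := by
  subst hb
  set b : ℝ := ((n - 2 * k - 1 : ℕ) : ℝ) with hbdef
  have hb1' : (1 : ℝ) ≤ b := by rw [hbdef]; exact_mod_cast hb1
  have hk' : (1 : ℝ) ≤ k := by exact_mod_cast hk
  have e1 : 0 < μ - b := by linarith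
  have e2 : 0 < μ - 1 := by linarith
  -- The same vector, with entries on the `2k`-clique summing to one; its equations there are the
  -- root equation.
  let y : Fin (2 * k) ⊕ (Fin (n - 2 * k - 1) ⊕ Fin 1) → ℝ :=
    Sum.elim (fun _ => 1 / (2 * k)) (Sum.elim (fun _ => 1 / (μ - b)) (fun _ => 1 / (μ - 1)))
  have hroot' : μ * (μ - 1) * (μ - b - 2 * k) = 2 * k * (μ - b) := by linarith
  refine le_adjSpectralRadius _ (y := y) ?_ ?_
  · intro h
    have := congrFun h (Sum.inr (Sum.inr 0))
    simp only [y, Sum.elim_inr, Pi.zero_apply] at this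
    exact absurd this (one_div_pos.mpr e2).ne'
  · have hfilter : ∀ v, ∑ u ∈ (extremalGraph n k).neighborFinset v, y u
        = ∑ u, if (extremalGraph n k).Adj v u then y u else 0 := by
      intro v
      rw [neighborFinset_eq_filter, Finset.sum_filter]
    have hcount : ∀ (N : ℕ) (i : Fin N) (r : ℝ),
        (∑ j : Fin N, if i = j then 0 else r) = N * r - r := by
      intro N i r
      have : ∀ j : Fin N, (if i = j then 0 else r) = r - if i = j then r else 0 := by
        intro j; split_ifs <;> simp
      simp_rw [this, Finset.sum_sub_distrib, Finset.sum_ite_eq]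
      simp
    intro v
    rw [hfilter]
    rcases v with i | i | i
    · simp [extremalGraph, joinGraph, y, hcount, ← hbdef]
      field_simp
      linear_combination hroot
    · have h := hcount _ i (μ - b)⁻¹
      rw [← hbdef] at h
      simp [extremalGraph, joinGraph, y]
      trans 2 * k * ((k : ℝ)⁻¹ * 2⁻¹) + (b * (μ - b)⁻¹ - (μ - b)⁻¹)
      · congr 1
        convert h
      · field_simp
        ring
    · have hi : i = 0 := Subsingleton.elim _ _
      simp [extremalGraph, joinGraph, y, hi]
      field_simp

end SimpleGraph

/-! ### Optimal partitions into pieces -/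

theorem Finset.add_card_le_sum_add_one {ι : Type*} (C : Finset ι) (m : ι → ℕ)
    (hm : ∀ c ∈ C, 1 ≤ m c) {c : ι} (hc : c ∈ C) : m c + C.card ≤ ∑ c ∈ C, m c + 1 := by
  classical
  rw [← Finset.add_sum_erase C m hc, ← Finset.card_erase_add_one hc]
  have h : (C.erase c).card • 1 ≤ ∑ c ∈ C.erase c, m c :=
    Finset.card_nsmul_le_sum _ _ _ fun d hd => hm d (Finset.mem_of_mem_erase hd)
  rw [smul_eq_mul, mul_one] at h
  omega

/-- Among the partitions of a number into at least `q` positive parts, `∑ m / (μ - m)` is largest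
when there are `q` parts, all of which except one are equal to one. -/
theorem one_add_sum_div_sub_le {ι : Type*} (C : Finset ι) (m : ι → ℕ) (hm : ∀ c ∈ C, 1 ≤ m c)
    {q : ℕ} (hq : q ≤ C.card) {a μ : ℝ} (ha : a + q = ∑ c ∈ C, (m c : ℝ) + 1) (ha1 : 1 ≤ a)
    (haμ : a < μ) :
    1 + ∑ c ∈ C, m c / (μ - m c) ≤ μ / (μ - a) + (q - 1) / (μ - 1) ∧
      (1 + ∑ c ∈ C, m c / (μ - m c) = μ / (μ - a) + (q - 1) / (μ - 1) →
        C.card = q ∧ ∀ c ∈ C, (m c : ℝ) = 1 ∨ (m c : ℝ) = a) := by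
  have e1 : 0 < μ - a := by linarith
  have e2 : 0 < μ - 1 := by linarith
  have e3 : 0 < μ := by linarith
  have hm1 : ∀ c ∈ C, (1 : ℝ) ≤ m c := fun c hc => by exact_mod_cast hm c hc
  have hqR : (q : ℝ) ≤ C.card := by exact_mod_cast hq
  have hma : ∀ c ∈ C, (m c : ℝ) ≤ a := by
    intro c hc
    have h : ((m c + C.card : ℕ) : ℝ) ≤ ((∑ c ∈ C, m c + 1 : ℕ) : ℝ) :=
      Nat.cast_le.mpr (C.add_card_le_sum_add_one m hm hc)
    push_cast at h
    linarith
  set r : ℝ := μ / ((μ - a) * (μ - 1)) with hr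
  have hchord : ∀ c ∈ C, (m c : ℝ) / (μ - m c) ≤ 1 / (μ - 1) + (m c - 1) * r := fun c hc =>
    div_sub_le_chord (hm1 c hc) (hma c hc) haμ
  have hsum : ∑ c ∈ C, (1 / (μ - 1) + ((m c : ℝ) - 1) * r)
      = C.card * (1 / (μ - 1)) + (a + q - 1 - C.card) * r := by
    rw [Finset.sum_add_distrib, ← Finset.sum_mul, Finset.sum_sub_distrib, ha]
    simp
  -- Each part beyond `q` costs a fixed positive amount, so equality forces exactly `q` parts, all
  -- at ends of the chord.
  have hgap : μ / (μ - a) + (q - 1) / (μ - 1)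
      = 1 + (C.card * (1 / (μ - 1)) + (a + q - 1 - C.card) * r)
        + (C.card - q) * (a / ((μ - a) * (μ - 1))) := by
    rw [hr]
    field_simp
    ring
  have hpos : 0 < a / ((μ - a) * (μ - 1)) := by positivity
  have hnn := mul_nonneg (sub_nonneg.mpr hqR) hpos.le
  have hle := Finset.sum_le_sum hchord
  rw [hsum] at hle
  refine ⟨by linarith, fun heq => ?_⟩
  have h1 : (C.card - q : ℝ) * (a / ((μ - a) * (μ - 1))) = 0 := by linarith
  have h2 : (C.card : ℝ) = q := by
    rcases mul_eq_zero.mp h1 with h | h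
    · linarith
    · exact absurd h hpos.ne'
  refine ⟨by exact_mod_cast h2, fun c hc => ?_⟩
  exact eq_one_or_eq_of_div_sub_eq_chord (hm1 c hc) (hma c hc) haμ
    ((Finset.sum_eq_sum_iff_of_le hchord).mp (by rw [hsum]; linarith) c hc)

/-- The comparison of quotient polynomials: a partition into at least `max 2 (s - 2k + 2)` parts
next to a separating set of order `s` does no better than the partition of the extremal graph. -/
theorem mul_one_add_sum_div_sub_le {ι : Type*} (C : Finset ι) (m : ι → ℕ)
    (hm : ∀ c ∈ C, 1 ≤ m c) {s k b : ℕ} (hk : 1 ≤ k) (hb : 1 ≤ b)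
    (hsum : s + ∑ c ∈ C, m c = b + 2 * k + 1) (hC : 2 ≤ C.card) (hsC : s + 2 ≤ C.card + 2 * k)
    {μ : ℝ} (hμ : (b + 2 * k : ℝ) < μ)
    (hroot : (2 * k : ℝ) * (μ * (μ - 1) + (μ - b)) = μ * (μ - 1) * (μ - b)) :
    s * (1 + ∑ c ∈ C, m c / (μ - m c)) ≤ μ ∧
      (s * (1 + ∑ c ∈ C, m c / (μ - m c)) = μ → s = 2 * k ∧ C.card = 2 ∧ ∃ c ∈ C, m c = 1) := by
  have hCm : C.card ≤ ∑ c ∈ C, m c := by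
    simpa using Finset.card_nsmul_le_sum C m 1 hm
  have hk' : (1 : ℝ) ≤ k := by exact_mod_cast hk
  have hb' : (1 : ℝ) ≤ b := by exact_mod_cast hb
  have hsumR : (s : ℝ) + ∑ c ∈ C, (m c : ℝ) = b + 2 * k + 1 := by exact_mod_cast hsum
  have hs0 : (0 : ℝ) ≤ s := Nat.cast_nonneg s
  rcases lt_trichotomy s (2 * k) with hlt | heq | hgt
  · have hlt' : (s : ℝ) < 2 * k := by exact_mod_cast hlt
    have h1 := (one_add_sum_div_sub_le C m hm (q := 2) hC (a := b + (2 * k - s)) (μ := μ)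
      (by push_cast; linarith) (by linarith) (by linarith)).1
    have h2 := quotient_lt_of_gt s (2 * k) b hs0 hlt' hb' hμ hroot
    have h3 := mul_le_mul_of_nonneg_left h1 hs0
    norm_num at h2 h3
    exact ⟨by linarith, fun h => by linarith⟩
  · classical
    have hsR : (s : ℝ) = 2 * k := by rw [heq]; push_cast; ring
    have h1 := one_add_sum_div_sub_le C m hm (q := 2) hC (a := b) (μ := μ)
      (by push_cast; linarith) hb' (by linarith)
    have e1 : 0 < μ - b := by linarith
    have e2 : 0 < μ - 1 := by linarith
    have hval : (2 * k : ℝ) * (μ / (μ - b) + ((2 : ℕ) - 1) / (μ - 1)) = μ := by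
      push_cast
      field_simp
      linear_combination hroot
    have hspos : (0 : ℝ) < 2 * k := by linarith
    have h3 := mul_le_mul_of_nonneg_left h1.1 hspos.le
    rw [hsR]
    refine ⟨by linarith, fun h => ?_⟩
    obtain ⟨hcard, hparts⟩ := h1.2 (mul_left_cancel₀ hspos.ne' (h.trans hval.symm))
    refine ⟨heq, hcard, ?_⟩
    obtain ⟨c, d, hcd, rfl⟩ := Finset.card_eq_two.mp hcard
    rw [Finset.sum_pair hcd] at hsum
    rcases hparts c (by simp) with h | h
    · exact ⟨c, by simp, by exact_mod_cast h⟩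
    · have h' : m c = b := by exact_mod_cast h
      exact ⟨d, by simp, by omega⟩
  · obtain ⟨j, rfl⟩ := Nat.exists_eq_add_of_lt hgt
    -- Here `s = 2k + j + 1`, so there are at least `j + 3` parts; with `j + 2` singletons the large
    -- part is `a`.
    obtain ⟨a, rfl⟩ : ∃ a, b = a + 2 * (j + 1) := ⟨b - 2 * (j + 1), by omega⟩
    have ha : 1 ≤ a := by omega
    have ha' : (1 : ℝ) ≤ a := by exact_mod_cast ha
    push_cast at *
    have h1 := (one_add_sum_div_sub_le C m hm (q := j + 3) (by omega) (a := a) (μ := μ)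
      (by push_cast; linarith) ha' (by linarith)).1
    have h2 := quotient_lt_of_lt (2 * k) (j + 1) a (by omega) (by omega) ha (μ := μ)
      (by push_cast; linarith) (by push_cast; linarith)
    have h3 := mul_le_mul_of_nonneg_left h1 hs0
    have h4 : ((j : ℝ) + 3 - 1) = j + 1 + 1 := by ring
    push_cast at h2 h3
    rw [h4, add_assoc (2 * (k : ℝ))] at h3
    rw [add_assoc (2 * (k : ℝ))]
    exact ⟨by linarith, fun h => by linarith⟩

/-! ### Recognising the extremal graph -/

namespace SimpleGraph

/-- The position of a vertex of the extremal graph: in the `2k`-clique, in the large clique, or the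
remaining vertex. -/
def extremalPart (n k : ℕ) : Fin (2 * k) ⊕ (Fin (n - 2 * k - 1) ⊕ Fin 1) → Fin 3 :=
  Sum.elim (fun _ => 0) (Sum.elim (fun _ => 1) (fun _ => 2))

theorem extremalGraph_adj (n k : ℕ) (u v : Fin (2 * k) ⊕ (Fin (n - 2 * k - 1) ⊕ Fin 1)) :
    (extremalGraph n k).Adj u v ↔ u ≠ v ∧
      (extremalPart n k u = 0 ∨ extremalPart n k v = 0 ∨ extremalPart n k u = extremalPart n k v) := by
  rcases u with u | u | u <;> rcases v with v | v | v <;>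
    simp [extremalGraph, joinGraph, extremalPart]

/-- For distinct vertices adjacency depends only on labels, so any label-preserving bijection is an
isomorphism; two fibre sizes and the order fix the third. -/
theorem nonempty_iso_extremalGraph {V : Type*} [Fintype V] {G : SimpleGraph V} {n k : ℕ}
    (hn : 2 * k + 1 ≤ n) (hV : Fintype.card V = n) (τ : V → Fin 3)
    (hadj : ∀ u v, G.Adj u v ↔ u ≠ v ∧ (τ u = 0 ∨ τ v = 0 ∨ τ u = τ v))
    (h0 : Nat.card {v // τ v = 0} = 2 * k) (h2 : Nat.card {v // τ v = 2} = 1) :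
    Nonempty (G ≃g extremalGraph n k) := by
  classical
  have hsum : ∑ i : Fin 3, Nat.card {v // τ v = i} = n := by
    rw [← hV, ← Nat.card_eq_fintype_card, ← Nat.card_congr (Equiv.sigmaFiberEquiv τ),
      Nat.card_sigma]
  rw [Fin.sum_univ_three, h0, h2] at hsum
  have hfib : ∀ i, Nonempty ({v // τ v = i} ≃ {w // extremalPart n k w = i}) := by
    intro i
    refine Finite.card_eq.mp ?_
    have hcard : Nat.card {w // extremalPart n k w = i}
        = if i = 0 then 2 * k else if i = 1 then n - 2 * k - 1 else 1 := by
      rw [Nat.card_eq_fintype_card, Fintype.card_subtype, Finset.card_filter]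
      fin_cases i <;> simp [extremalPart]
    rw [hcard]
    fin_cases i
    · simpa using h0
    · simp only [Fin.mk_one, Fin.isValue, one_ne_zero, if_false, if_true]
      omega
    · simpa using h2
  let e := fun i => (hfib i).some
  have hτ : ∀ v, extremalPart n k (Equiv.ofFiberEquiv e v) = τ v := Equiv.ofFiberEquiv_map e
  refine ⟨⟨Equiv.ofFiberEquiv e, ?_⟩⟩
  intro u v
  rw [extremalGraph_adj, hτ, hτ, hadj, (Equiv.ofFiberEquiv e).injective.ne_iff]

theorem not_isKExtendable_of_iso_extremalGraph {V : Type*} [Fintype V] {G : SimpleGraph V}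
    {n k : ℕ} (f : G ≃g extremalGraph n k) : ¬ G.IsKExtendable k := by
  refine not_isKExtendable_of_isClique G k (S := {v | extremalPart n k (f v) = 0})
    (w := f.symm (Sum.inr (Sum.inr 0))) ?_ ?_ ?_ ?_
  · intro u hu v hv huv
    rw [← f.map_adj_iff, extremalGraph_adj]
    exact ⟨f.injective.ne huv, Or.inl hu⟩
  · have : {v | extremalPart n k (f v) = 0} = f.symm '' Set.range Sum.inl := by
      ext v
      have : v ∈ f.symm '' Set.range Sum.inl ↔ ∃ y, Sum.inl y = f v := by
        simp [f.symm_apply_eq]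
      rw [this, Set.mem_ofPred_eq]
      generalize f v = w
      rcases w with w | w | w <;> simp [extremalPart]
    rw [this, Set.ncard_image_of_injective _ f.symm.injective, ← Set.image_univ,
      Set.ncard_image_of_injective _ Sum.inl_injective, Set.ncard_univ, Nat.card_eq_fintype_card,
      Fintype.card_fin]
  · simp [extremalPart]
  · intro v hv
    rw [← f.map_adj_iff, extremalGraph_adj, f.apply_symm_apply] at hv
    obtain ⟨hne, h⟩ := hv
    rcases hw : f v with w | w | w
    · simp [hw, extremalPart]
    · simp [hw, extremalPart] at h
    · exact absurd (by rw [hw, Subsingleton.elim w 0]) hne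

open Finset in
open Classical in
theorem nonempty_iso_extremalGraph_of_not_isKExtendable {V : Type*} [Fintype V]
    {G : SimpleGraph V} {n k : ℕ} (hk : 1 ≤ k) (hn : Even n) (hnk : 2 * k + 2 ≤ n)
    (hV : Fintype.card V = n) (hG : G.Connected)
    (hρ : (extremalGraph n k).adjSpectralRadius ≤ G.adjSpectralRadius)
    (hext : ¬ G.IsKExtendable k) : Nonempty (G ≃g extremalGraph n k) := by
  obtain ⟨S, κ, hκ, hq2, hqs⟩ := exists_separation_of_not_isKExtendable G k hk (by omega)
    (hV ▸ hn) hext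
  obtain ⟨b, rfl⟩ : ∃ b, n = b + 2 * k + 1 := ⟨n - 2 * k - 1, by omega⟩
  have hb : 1 ≤ b := by omega
  have hk' : (1 : ℝ) ≤ k := by exact_mod_cast hk
  obtain ⟨μ, hμ, hroot⟩ := exists_quotient_root (2 * k) b (by linarith) (by exact_mod_cast hb)
  have hρ' := (sub_one_le_adjSpectralRadius_extremalGraph (b + 2 * k + 1) k hk
    (b := b) (by omega) hb hμ hroot).trans hρ
  set C := Sᶜ.image κ with hC
  let m : Set V → ℕ := fun c => #{u ∈ Sᶜ | κ u = c}
  have hm : ∀ c ∈ C, 1 ≤ m c := by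
    intro c hc
    obtain ⟨v, hv, rfl⟩ := Finset.mem_image.mp hc
    exact Finset.card_pos.mpr ⟨v, by simpa using hv⟩
  have hsumC : ∑ c ∈ C, m c = #Sᶜ := (Finset.card_eq_sum_card_image κ Sᶜ).symm
  have hsum : #S + ∑ c ∈ C, m c = b + 2 * k + 1 := by
    rw [hsumC, Finset.card_add_card_compl, hV]
  have hT : ∑ v ∈ Sᶜ, 1 / (μ - #{u ∈ Sᶜ | κ u = κ v}) = ∑ c ∈ C, (m c : ℝ) / (μ - m c) := by
    rw [Finset.sum_comp (fun c => 1 / (μ - #{u ∈ Sᶜ | κ u = c})) κ]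
    refine Finset.sum_congr rfl fun c _ => ?_
    rw [nsmul_eq_mul, mul_one_div]
  obtain ⟨hle, heq⟩ := mul_one_add_sum_div_sub_le C m hm hk hb hsum hq2 hqs hμ hroot
  have hmμ : ∀ v ∉ S, (#{u ∈ Sᶜ | κ u = κ v} : ℝ) < μ := by
    intro v hv
    have hc : κ v ∈ C := Finset.mem_image_of_mem κ (Finset.mem_compl.mpr hv)
    have h := C.add_card_le_sum_add_one m hm hc
    have : m (κ v) ≤ b + 2 * k := by omega
    have : (m (κ v) : ℝ) ≤ b + 2 * k := by exact_mod_cast this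
    exact this.trans_lt hμ
  have hμ0 : 0 < μ := by
    have : (0 : ℝ) ≤ b := Nat.cast_nonneg b
    linarith
  obtain ⟨hμeq, hadj⟩ := hG.adj_iff_of_separation S κ hκ hμ0 hmμ (by rwa [hT]) hρ'
  rw [hT] at hμeq
  obtain ⟨hs, hC2, c, hc, hmc⟩ := heq hμeq
  -- There are only two pieces, so everything outside `S` and the singleton piece `c` is one clique.
  have hother : ∀ u v, u ∉ S → v ∉ S → κ u ≠ c → κ v ≠ c → κ u = κ v := by
    intro u v hu hv huc hvc
    have h1 : #(C.erase c) = 1 := by rw [Finset.card_erase_of_mem hc, hC2]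
    refine Finset.card_le_one.mp h1.le _ ?_ _ ?_
    · exact Finset.mem_erase.mpr ⟨huc, Finset.mem_image_of_mem κ (Finset.mem_compl.mpr hu)⟩
    · exact Finset.mem_erase.mpr ⟨hvc, Finset.mem_image_of_mem κ (Finset.mem_compl.mpr hv)⟩
  let τ : V → Fin 3 := fun v => if v ∈ S then 0 else if κ v = c then 2 else 1
  have hτ0 : ∀ v, τ v = 0 ↔ v ∈ S := by
    intro v
    simp only [τ]
    split_ifs <;> simp_all
  have hτ2 : ∀ v, τ v = 2 ↔ v ∈ Sᶜ ∧ κ v = c := by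
    intro v
    simp only [τ]
    split_ifs <;> simp_all
  refine nonempty_iso_extremalGraph (by omega) hV τ (fun u v => ?_) ?_ ?_
  · rw [hadj, hτ0, hτ0]
    refine and_congr_right fun _ => ?_
    by_cases hu : u ∈ S
    · simp [hu]
    by_cases hv : v ∈ S
    · simp [hv]
    have hτu : τ u = if κ u = c then 2 else 1 := if_neg hu
    have hτv : τ v = if κ v = c then 2 else 1 := if_neg hv
    rw [hτu, hτv]
    by_cases huc : κ u = c <;> by_cases hvc : κ v = c
    · simp [hu, hv, huc, hvc]
    · simp [hu, hv, huc, hvc, Ne.symm hvc]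
    · simp [hu, hv, huc, hvc]
    · simp [hu, hv, hvc, hother u v hu hv huc hvc]
  · rw [Nat.card_congr (Equiv.subtypeEquivRight hτ0), Nat.card_eq_fintype_card,
      Fintype.card_coe, hs]
  · rw [Nat.card_congr (Equiv.subtypeEquivRight hτ2), Nat.card_eq_fintype_card,
      Fintype.card_subtype, ← hmc]
    congr 1
    ext v
    simp

end SimpleGraph

theorem theorem1p4 {V : Type*} [Fintype V] (G : SimpleGraph V) (n k : ℕ)
    (hk : 1 ≤ k) (hn : Even n) (hnk : 2 * k + 2 ≤ n) (hV : Fintype.card V = n)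
    (hG : G.Connected)
    (hρ : (SimpleGraph.extremalGraph n k).adjSpectralRadius ≤ G.adjSpectralRadius) :
    (¬ Nonempty (G ≃g SimpleGraph.extremalGraph n k) → G.IsKExtendable k) ∧
      (Nonempty (G ≃g SimpleGraph.extremalGraph n k) → ¬ G.IsKExtendable k) := by
  refine ⟨fun h => ?_, fun ⟨f⟩ => SimpleGraph.not_isKExtendable_of_iso_extremalGraph f⟩
  by_contra hext
  exact h (SimpleGraph.nonempty_iso_extremalGraph_of_not_isKExtendable hk hn hnk hV hG hρ hext)
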